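/- For a finite Abelian group $\Gamma$ (written additively) and a subset $A\subseteq\Gamma$, let $\mathrm{Cay}(\Gamma,A)$ be the Cayley digraph with vertex set $\Gamma$ and an arc from $x$ to $x+a$ for every $x\in\Gamma$ and $a\in A$. Its diameter is the maximum, over all ordered pairs $(u,v)$ of vertices, of the length of a shortest directed path from $u$ to $v$ (and $\infty$ if for some pair there is none). For positive integers $d$ and $k$, let $m_*(d,k)$ be the largest positive integer $m$ such that there exist an Abelian group $\Gamma$ with $m$ elements and a generating subset $A\subseteq\Gamma$ with exactly $k$ elements such that $\mathrm{diam}(\mathrm{Cay}(\Gamma,A))\le d$. Let $m(d,k)$ be the largest positive integer $m$ such that the cyclic group $\mathbb{Z}_m=\mathbb{Z}/m\mathbb{Z}$ has a generating subset $A$ with exactly $k$ elements such that $\mathrm{diam}(\mathrm{Cay}(\mathbb{Z}_m,A))\le d$. **Proposition.** For every integer $d\ge 2$, both maxima $m_*(d,2)$ and $m(d,2)$ exist, $$m(d,2)=\left\lceil\frac{(d+2)^2}{3}\right\rceil-1,$$ and $$m_*(d,2)=\begin{cases} m(d,2)+1, & \text{if } d\equiv 1 \pmod 3,\\ m(d,2),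 & \text{otherwise.}\end{cases}$$ In particular, the equality $m_*(d,k)=m(d,k)$ fails already for $k=2$: there is some $d\ge 2$ with $m_*(d,2)\ne m(d,2)$. -/

import Mathlib

/-- `G.HasWalk n u v`: the digraph `G` has a directed walk with exactly `n` arcs from `u` to `v`. -/
def Digraph.HasWalk {V : Type*} (G : Digraph V) : ℕ → V → V → Prop
  | 0, u, v => u = v
  | n + 1, u, v => ∃ w, G.Adj u w ∧ Digraph.HasWalk G n w v

/-- The directed distance from `u` to `v`: the least length of a directed walk from `u` to `v`,
and `⊤` if there is none. -/
noncomputable def Digraph.directedDist {V : Type*} (G : Digraph V) (u v : V) : ℕ∞ :=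
  ⨅ (n : ℕ) (_ : G.HasWalk n u v), (n : ℕ∞)

/-- The diameter of a digraph: the supremum of the directed distances over all ordered pairs of
vertices (`⊤` if some vertex cannot be reached from another one). -/
noncomputable def Digraph.directedDiam {V : Type*} (G : Digraph V) : ℕ∞ :=
  ⨆ (u : V) (v : V), G.directedDist u v

/-- The Cayley digraph `Cay(Γ, A)` of an (additively written) Abelian group: its vertices are the
elements of `Γ`, and its arcs are the pairs `(x, x + a)` with `a ∈ A`. -/
def cayleyDigraph (Γ : Type*) [AddCommGroup Γ] (A : Finset Γ) : Digraph Γ where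
  Adj x y := ∃ a ∈ A, y = x + a

/-- `Γ` has a generating subset `A` with exactly `k` elements such that
`diam (Cay(Γ, A)) ≤ d`. -/
def HasCayleyDiamLE (Γ : Type*) [AddCommGroup Γ] (d k : ℕ) : Prop :=
  ∃ A : Finset Γ, A.card = k ∧ AddSubgroup.closure (A : Set Γ) = ⊤ ∧
    (cayleyDigraph Γ A).directedDiam ≤ (d : ℕ∞)

/-- The positive integers `m` for which some Abelian group with `m` elements has a `k`-element
generating subset with Cayley digraph of diameter at most `d`.  (Finite groups of every universe
have isomorphic copies in `Type`.) -/
def abelianOrders (d k : ℕ) : Set ℕ :=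
  {m | 0 < m ∧ ∃ (Γ : Type) (_ : AddCommGroup Γ), Nat.card Γ = m ∧ HasCayleyDiamLE Γ d k}

/-- The positive integers `m` for which the cyclic group `ℤ/mℤ` has a `k`-element
generating subset with Cayley digraph of diameter at most `d`. -/
def cyclicOrders (d k : ℕ) : Set ℕ :=
  {m | 0 < m ∧ HasCayleyDiamLE (ZMod m) d k}

/-- `m_*(d, k)`, the largest element of `abelianOrders d k`. -/
noncomputable def mStar (d k : ℕ) : ℕ := sSup (abelianOrders d k)

/-- `m(d, k)`, the largest element of `cyclicOrders d k`. -/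
noncomputable def mCyc (d k : ℕ) : ℕ := sSup (cyclicOrders d k)

/-! Diameter at most `d` for generators `a, b` means that every group element is `i • a + j • b`
with `i + j ≤ d`. Choosing for each element its least pair `(i, j)` gives a staircase in `ℕ²` closed
downwards. Every inner corner of it represents `0`, and two corners would yield two least pairs for
one element, so the staircase is a rectangle or an L-shape (`exists_lShape`). Its outer corners
satisfy `i + j ≤ d`; maximizing the area gives `3 * |G| ≤ (d + 2) ^ 2`.

Equality forces one shape, whose relations make the exponent of `G` divide `d + 2`
(`Covers.nsmul_eq_zero`); a cyclic group of order `(d + 2) ^ 2 / 3 > d + 2` is thus excluded.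
Explicit generators reach the resulting bounds, and `ZMod t × ZMod (3 * t)` attains equality when `d
+ 2 = 3 * t`. Only for `d ≡ 1 [MOD 3]` is `(d + 2) ^ 2` divisible by `3`, so only there do the two
maxima differ. -/

namespace CayleyTwo

variable {G : Type*} [AddCommGroup G]

/-- Every element of `G` is `i • a + j • b` with `i + j ≤ d`. -/
def Covers (a b : G) (d : ℕ) : Prop :=
  ∀ g : G, ∃ i j : ℕ, i + j ≤ d ∧ i • a + j • b = g

/-! ### Diameter as a covering condition -/

theorem exists_nsmul_of_hasWalk [DecidableEq G] {a b : G} {n : ℕ} {u v : G}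
    (h : (cayleyDigraph G {a, b}).HasWalk n u v) :
    ∃ i j : ℕ, i + j = n ∧ u + (i • a + j • b) = v := by
  induction n generalizing u with
  | zero => exact ⟨0, 0, rfl, by simpa [Digraph.HasWalk] using h⟩
  | succ n ih =>
    obtain ⟨w, ⟨x, hx, rfl⟩, hw⟩ := h
    obtain ⟨i, j, hij, hv⟩ := ih hw
    rcases Finset.mem_insert.1 hx with rfl | hx
    · exact ⟨i + 1, j, by omega, by rw [← hv, succ_nsmul]; abel⟩
    · rw [Finset.mem_singleton.1 hx] at hv
      exact ⟨i, j + 1, by omega, by rw [← hv, succ_nsmul]; abel⟩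

theorem hasWalk_nsmul [DecidableEq G] (a b : G) (i j : ℕ) (u : G) :
    (cayleyDigraph G {a, b}).HasWalk (i + j) u (u + (i • a + j • b)) := by
  induction i generalizing u with
  | zero =>
    induction j generalizing u with
    | zero => simp [Digraph.HasWalk]
    | succ j ih =>
      rw [← Nat.add_assoc]
      refine ⟨u + b, ⟨b, by simp, rfl⟩, ?_⟩
      convert ih (u + b) using 1
      rw [succ_nsmul]; abel
  | succ i ih =>
    rw [Nat.succ_add]
    refine ⟨u + a, ⟨a, by simp, rfl⟩, ?_⟩
    convert ih (u + a) using 1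
    rw [succ_nsmul]; abel

theorem directedDist_le_iff {V : Type*} (D : Digraph V) (u v : V) (d : ℕ) :
    D.directedDist u v ≤ d ↔ ∃ n ≤ d, D.HasWalk n u v := by
  constructor
  · intro h
    by_contra! hc
    have : ((d + 1 : ℕ) : ℕ∞) ≤ D.directedDist u v := by
      refine le_iInf₂ fun n hn => ?_
      have : ¬ n ≤ d := fun hnd => hc n hnd hn
      exact_mod_cast (by omega : d + 1 ≤ n)
    have := this.trans h
    norm_cast at this
    omega
  · rintro ⟨n, hn, hw⟩
    exact (iInf₂_le n hw).trans (by exact_mod_cast hn)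

theorem directedDiam_le_iff_covers [DecidableEq G] (a b : G) (d : ℕ) :
    (cayleyDigraph G {a, b}).directedDiam ≤ d ↔ Covers a b d := by
  simp only [Digraph.directedDiam, iSup_le_iff, directedDist_le_iff]
  constructor
  · intro h g
    obtain ⟨n, hn, hw⟩ := h 0 g
    obtain ⟨i, j, hij, hg⟩ := exists_nsmul_of_hasWalk hw
    exact ⟨i, j, by omega, by simpa using hg⟩
  · intro h u v
    obtain ⟨i, j, hij, hg⟩ := h (v - u)
    refine ⟨i + j, hij, ?_⟩
    have := hasWalk_nsmul a b i j u
    rwa [hg, add_sub_cancel] at this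

theorem hasCayleyDiamLE_two_iff (d : ℕ) :
    HasCayleyDiamLE G d 2 ↔ ∃ a b : G, a ≠ b ∧ Covers a b d := by
  classical
  constructor
  · rintro ⟨A, hA, -, hd⟩
    obtain ⟨a, b, hab, rfl⟩ := Finset.card_eq_two.1 hA
    exact ⟨a, b, hab, (directedDiam_le_iff_covers a b d).1 hd⟩
  · rintro ⟨a, b, hab, hd⟩
    refine ⟨{a, b}, Finset.card_pair hab, ?_, (directedDiam_le_iff_covers a b d).2 hd⟩
    rw [eq_top_iff]
    intro g _
    obtain ⟨i, j, -, rfl⟩ := hd g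
    exact add_mem (nsmul_mem (AddSubgroup.subset_closure (by simp)) _)
      (nsmul_mem (AddSubgroup.subset_closure (by simp)) _)

/-! ### Minimal representatives -/

/-- `(i, j)` is the smallest pair representing `i • a + j • b`, where pairs are ordered by the sum
of their entries and then by the second entry. -/
def IsMinRep (a b : G) (i j : ℕ) : Prop :=
  ∀ i' j' : ℕ, i' • a + j' • b = i • a + j • b →
    i + j < i' + j' ∨ (i + j = i' + j' ∧ j ≤ j')

section MinRep

variable {a b : G} {d : ℕ}

/-- The order on pairs is translation invariant, so improving a smaller pair would improve the
larger one. -/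
theorem IsMinRep.mono {i j k l : ℕ} (h : IsMinRep a b k l) (hi : i ≤ k) (hj : j ≤ l) :
    IsMinRep a b i j := by
  obtain ⟨x, rfl⟩ := Nat.exists_eq_add_of_le hi
  obtain ⟨y, rfl⟩ := Nat.exists_eq_add_of_le hj
  intro i' j' he
  have := h (i' + x) (j' + y) (by
    simp only [add_nsmul]
    rw [add_add_add_comm, he, add_add_add_comm])
  omega

theorem IsMinRep.unique {i j k l : ℕ} (h : IsMinRep a b i j) (h' : IsMinRep a b k l)
    (he : i • a + j • b = k • a + l • b) : i = k ∧ j = l := by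
  have h1 := h k l he.symm
  have h2 := h' i j he
  omega

theorem exists_isMinRep (i j : ℕ) :
    ∃ k l : ℕ, IsMinRep a b k l ∧ k • a + l • b = i • a + j • b := by
  classical
  have h1 : ∃ n k l : ℕ, k + l = n ∧ k • a + l • b = i • a + j • b := ⟨i + j, i, j, rfl, rfl⟩
  have h2 : ∃ l k : ℕ, k + l = Nat.find h1 ∧ k • a + l • b = i • a + j • b := by
    obtain ⟨k, l, h⟩ := Nat.find_spec h1
    exact ⟨l, k, h⟩
  obtain ⟨k, hk, he⟩ := Nat.find_spec h2
  refine ⟨k, Nat.find h2, fun i' j' h' => ?_, he⟩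
  rw [he] at h'
  have h3 : Nat.find h1 ≤ i' + j' := Nat.find_min' h1 ⟨i', j', rfl, h'⟩
  rcases h3.lt_or_eq with h | h
  · left; omega
  · exact Or.inr ⟨by omega, Nat.find_min' h2 ⟨i', h.symm, h'⟩⟩

theorem IsMinRep.add_le (hc : Covers a b d) {i j : ℕ} (h : IsMinRep a b i j) : i + j ≤ d := by
  obtain ⟨k, l, hkl, he⟩ := hc (i • a + j • b)
  have := h k l he
  omega

theorem Covers.exists_isMinRep (hc : Covers a b d) (g : G) :
    ∃ i j : ℕ, IsMinRep a b i j ∧ i • a + j • b = g := by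
  obtain ⟨i, j, -, rfl⟩ := hc g
  exact CayleyTwo.exists_isMinRep i j

/-- If `(p + 1, q)` is not a minimal representative but `(p, q)` is, then the minimal
representative of the former has first entry `0`. -/
theorem exists_isMinRep_zero_left {p q : ℕ} (h : ¬ IsMinRep a b (p + 1) q)
    (h' : IsMinRep a b p q) :
    ∃ s, IsMinRep a b 0 s ∧ s • b = (p + 1) • a + q • b := by
  obtain ⟨r, s, hr, he⟩ := exists_isMinRep (a := a) (b := b) (p + 1) q
  rcases r with _ | r
  · exact ⟨s, hr, by simpa using he⟩
  -- Cancelling one `a` leaves two minimal pairs for the same element, so `(r, s) = (p, q)`.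
  · obtain ⟨rfl, rfl⟩ := (hr.mono (Nat.le_succ r) le_rfl).unique h' (by
      have := congrArg (· - a) he
      simpa [succ_nsmul, add_sub_assoc, add_right_comm _ a] using this)
    exact absurd hr h

theorem exists_isMinRep_zero_right {p q : ℕ} (h : ¬ IsMinRep a b p (q + 1))
    (h' : IsMinRep a b p q) :
    ∃ r, IsMinRep a b r 0 ∧ r • a = p • a + (q + 1) • b := by
  obtain ⟨r, s, hr, he⟩ := exists_isMinRep (a := a) (b := b) p (q + 1)
  rcases s with _ | s
  · exact ⟨r, hr, by simpa using he⟩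
  · obtain ⟨rfl, rfl⟩ := (hr.mono le_rfl (Nat.le_succ s)).unique h' (by
      rw [succ_nsmul, succ_nsmul, ← add_assoc, ← add_assoc] at he
      exact add_right_cancel he)
    exact absurd hr h

/-! ### Inner corners of the staircase -/

/-- An inner corner of the staircase of minimal representatives. -/
def IsCorner (a b : G) (p q : ℕ) : Prop :=
  ¬ IsMinRep a b (p + 1) (q + 1) ∧ IsMinRep a b p (q + 1) ∧ IsMinRep a b (p + 1) q

/-- The least pair of the corner element lies on both axes, so it is `(0, 0)`. -/
theorem IsCorner.eq_zero {p q : ℕ} (h : IsCorner a b p q) :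
    (p + 1) • a + (q + 1) • b = 0 := by
  obtain ⟨s, hs, he⟩ := exists_isMinRep_zero_left h.1 h.2.1
  obtain ⟨r, hr, he'⟩ := exists_isMinRep_zero_right h.1 h.2.2
  obtain ⟨-, rfl⟩ := hs.unique hr (by simp [he, he'])
  simpa using he.symm

/-- Both corners represent `0`; subtracting gives `(x + 1) • a = (y + 1) • b` with both sides
minimal. -/
theorem IsCorner.unique_of_lt {p q p' q' : ℕ} (h : IsCorner a b p q) (h' : IsCorner a b p' q')
    (hp : p < p') : False := by
  have hq : q' < q := by
    by_contra hq
    exact h.1 (h'.2.1.mono (by omega) (by omega))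
  obtain ⟨x, rfl⟩ := Nat.exists_eq_add_of_lt hp
  obtain ⟨y, rfl⟩ := Nat.exists_eq_add_of_lt hq
  have h1 : IsMinRep a b (x + 1) 0 := h'.2.2.mono (by omega) (by omega)
  have h2 : IsMinRep a b 0 (y + 1) := h.2.1.mono (by omega) (by omega)
  have he := h.eq_zero.trans h'.eq_zero.symm
  have := h1.unique h2 (by
    have e1 : (p + x + 1 + 1) • a = (p + 1) • a + (x + 1) • a := by rw [← add_nsmul]; congr 1; omega
    have e2 : (q' + y + 1 + 1) • b = (q' + 1) • b + (y + 1) • b := by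
      rw [← add_nsmul]; congr 1; omega
    rw [e1, e2] at he
    simp only [zero_nsmul, add_zero, zero_add]
    have : (p + 1) • a + (q' + 1) • b + (y + 1) • b =
        (p + 1) • a + (q' + 1) • b + (x + 1) • a := by
      rw [add_assoc, he]; abel
    exact (add_left_cancel this).symm)
  omega

theorem IsCorner.unique {p q p' q' : ℕ} (h : IsCorner a b p q) (h' : IsCorner a b p' q') :
    p = p' ∧ q = q' := by
  have hp : p = p' := by
    rcases lt_trichotomy p p' with hp | hp | hp
    · exact (h.unique_of_lt h' hp).elim
    · exact hp
    · exact (h'.unique_of_lt h hp).elim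
  subst hp
  refine ⟨rfl, ?_⟩
  rcases lt_trichotomy q q' with hq | hq | hq
  · exact absurd (h'.2.2.mono le_rfl (by omega)) h.1
  · exact hq
  · exact absurd (h.2.2.mono le_rfl (by omega)) h'.1

theorem exists_isCorner_le {i j : ℕ} (h : ¬ IsMinRep a b i j) (hi : IsMinRep a b i 0)
    (hj : IsMinRep a b 0 j) : ∃ p q, IsCorner a b p q ∧ p + 1 ≤ i ∧ q + 1 ≤ j := by
  obtain ⟨n, hn⟩ : ∃ n, i + j = n := ⟨_, rfl⟩
  induction n generalizing i j with
  | zero =>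
    obtain ⟨rfl, rfl⟩ : i = 0 ∧ j = 0 := by omega
    exact absurd hj h
  | succ n ih =>
    rcases i with _ | i
    · exact absurd hj h
    rcases j with _ | j
    · exact absurd hi h
    by_cases h1 : IsMinRep a b i (j + 1)
    · by_cases h2 : IsMinRep a b (i + 1) j
      · exact ⟨i, j, ⟨h, h1, h2⟩, le_rfl, le_rfl⟩
      · obtain ⟨p, q, hc, hp, hq⟩ := ih h2 hi (hj.mono le_rfl (by omega)) (by omega)
        exact ⟨p, q, hc, hp, by omega⟩
    · obtain ⟨p, q, hc, hp, hq⟩ := ih h1 (hi.mono (by omega) le_rfl) hj (by omega)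
      exact ⟨p, q, hc, by omega, hq⟩

/-! ### Area of the L-shape and the upper bound -/

theorem card_le_of_lShape {m n p q : ℕ} (hc : Covers a b d)
    (h : ∀ i j, IsMinRep a b i j → i < m ∧ j < n ∧ ¬ (p ≤ i ∧ q ≤ j)) :
    Nat.card G ≤ m * q + p * (n - q) := by
  let F := Finset.range m ×ˢ Finset.range q ∪ Finset.range p ×ˢ Finset.Ico q n
  have hF : F.card ≤ m * q + p * (n - q) := by
    refine (Finset.card_union_le _ _).trans ?_
    simp
  refine le_trans ?_ hF
  rw [← Set.ncard_coe_finset, ← Nat.card_coe_set_eq]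
  refine Nat.card_le_card_of_surjective (fun x : (F : Set (ℕ × ℕ)) => x.1.1 • a + x.1.2 • b) ?_
  intro g
  obtain ⟨i, j, hm, rfl⟩ := hc.exists_isMinRep g
  refine ⟨⟨(i, j), ?_⟩, rfl⟩
  have := h i j hm
  simp only [F, Finset.coe_union, Set.mem_union, Finset.mem_coe, Finset.mem_product,
    Finset.mem_range, Finset.mem_Ico]
  omega

/-- The minimal representatives form a rectangle or an L-shape. -/
theorem exists_lShape (hc : Covers a b d) : ∃ m n p q : ℕ,
    (∀ i j, IsMinRep a b i j ↔ i < m ∧ j < n ∧ ¬ (p ≤ i ∧ q ≤ j)) ∧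
    0 < p ∧ 0 < q ∧ q ≤ n ∧ m + q ≤ d + 2 ∧ p + n ≤ d + 2 ∧
    ((p = m ∧ q = n) ∨ (p < m ∧ q < n ∧ p • a + q • b = 0)) := by
  classical
  have hx : ∃ i, ¬ IsMinRep a b i 0 := ⟨d + 1, fun h => by have := h.add_le hc; omega⟩
  have hy : ∃ j, ¬ IsMinRep a b 0 j := ⟨d + 1, fun h => by have := h.add_le hc; omega⟩
  have h00 : IsMinRep a b 0 0 := by
    intro i j _
    omega
  obtain ⟨m, hm⟩ : ∃ m, ∀ i, IsMinRep a b i 0 ↔ i < m := ⟨Nat.find hx, fun i =>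
    ⟨fun h => by by_contra hlt; exact Nat.find_spec hx (h.mono (by omega) le_rfl),
      fun h => by_contra fun hn => Nat.find_min hx h hn⟩⟩
  obtain ⟨n, hn⟩ : ∃ n, ∀ j, IsMinRep a b 0 j ↔ j < n := ⟨Nat.find hy, fun i =>
    ⟨fun h => by by_contra hlt; exact Nat.find_spec hy (h.mono le_rfl (by omega)),
      fun h => by_contra fun hn => Nat.find_min hy h hn⟩⟩
  have hm0 := (hm 0).1 h00
  have hn0 := (hn 0).1 h00
  have hlt : ∀ i j, IsMinRep a b i j → i < m ∧ j < n := fun i j h =>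
    ⟨(hm i).1 (h.mono le_rfl (Nat.zero_le _)), (hn j).1 (h.mono (Nat.zero_le _) le_rfl)⟩
  by_cases hcor : ∃ p q, IsCorner a b p q
  · obtain ⟨p, q, hpq⟩ := hcor
    have key : ∀ i j, IsMinRep a b i j ↔ i < m ∧ j < n ∧ ¬ (p + 1 ≤ i ∧ q + 1 ≤ j) := by
      intro i j
      constructor
      · intro h
        exact ⟨(hlt i j h).1, (hlt i j h).2, fun hle => hpq.1 (h.mono hle.1 hle.2)⟩
      · rintro ⟨hi, hj, hle⟩
        by_contra h
        obtain ⟨p', q', hc', hp', hq'⟩ := exists_isCorner_le h ((hm i).2 hi) ((hn j).2 hj)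
        obtain ⟨rfl, rfl⟩ := hpq.unique hc'
        exact hle ⟨hp', hq'⟩
    have hpm := (hlt _ _ hpq.2.2).1
    have hqn := (hlt _ _ hpq.2.1).2
    -- The two outer corners of the L-shape have coordinate sum at most `d`.
    have h1 := ((key (m - 1) q).2 (by omega)).add_le hc
    have h2 := ((key p (n - 1)).2 (by omega)).add_le hc
    exact ⟨m, n, p + 1, q + 1, key, by omega, by omega, by omega, by omega, by omega,
      Or.inr ⟨hpm, hqn, hpq.eq_zero⟩⟩
  · have key : ∀ i j, IsMinRep a b i j ↔ i < m ∧ j < n := by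
      refine fun i j => ⟨hlt i j, fun ⟨hi, hj⟩ => ?_⟩
      by_contra h
      obtain ⟨p', q', hc', -⟩ := exists_isCorner_le h ((hm i).2 hi) ((hn j).2 hj)
      exact hcor ⟨p', q', hc'⟩
    have h1 := ((key (m - 1) (n - 1)).2 (by omega)).add_le hc
    refine ⟨m, n, m, n, fun i j => ?_, hm0, hn0, le_rfl, by omega, by omega, Or.inl ⟨rfl, rfl⟩⟩
    rw [key]
    omega

/-- Replacing `m` by `D - q` and `n` by `D - p` bounds `N` by a quadratic in `p, q`; completing
squares gives the left side, which also identifies the equality case. -/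
theorem lShape_area_le {D m n p q N : ℕ} (hN : N ≤ m * q + p * (n - q)) (hq : q ≤ n)
    (h1 : m + q ≤ D) (h2 : p + n ≤ D) :
    (2 * (D : ℤ) - 3 * (p + q)) ^ 2 + 3 * ((p : ℤ) - q) ^ 2 ≤ 4 * ((D : ℤ) ^ 2 - 3 * N) := by
  zify [hq] at hN h1 h2
  have e1 : (m : ℤ) * q ≤ (D - q) * q :=
    mul_le_mul_of_nonneg_right (by linarith) (Int.natCast_nonneg q)
  have e2 : (p : ℤ) * (n - q) ≤ p * (D - p - q) :=
    mul_le_mul_of_nonneg_left (by linarith) (Int.natCast_nonneg p)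
  nlinarith

theorem Covers.three_mul_card_le (hc : Covers a b d) : 3 * Nat.card G ≤ (d + 2) ^ 2 := by
  obtain ⟨m, n, p, q, key, hp, hq, hqn, h1, h2, -⟩ := exists_lShape hc
  have := lShape_area_le (card_le_of_lShape hc fun i j h => (key i j).1 h) hqn h1 h2
  zify
  push_cast at this
  nlinarith [sq_nonneg (2 * ((d : ℤ) + 2) - 3 * (p + q)), sq_nonneg ((p : ℤ) - q)]

/-- In the extremal case, the group has exponent dividing `d + 2`. -/
theorem Covers.nsmul_eq_zero (hc : Covers a b d) (hcard : 3 * Nat.card G = (d + 2) ^ 2) (g : G) :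
    (d + 2) • g = 0 := by
  obtain ⟨m, n, p, q, key, hp, hq, hqn, h1, h2, hor⟩ := exists_lShape hc
  have hN := card_le_of_lShape hc fun i j h => (key i j).1 h
  have hle := lShape_area_le hN hqn h1 h2
  zify at hcard
  push_cast at hle
  rw [hcard, sub_self, mul_zero] at hle
  have hpq : (p : ℤ) - q = 0 := by
    have := sq_nonneg (2 * ((d : ℤ) + 2) - 3 * (p + q))
    have := sq_nonneg ((p : ℤ) - q)
    exact pow_eq_zero_iff two_ne_zero |>.1 (by linarith)
  have hd : 2 * ((d : ℤ) + 2) - 3 * (p + q) = 0 := by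
    have := sq_nonneg (2 * ((d : ℤ) + 2) - 3 * (p + q))
    have := sq_nonneg ((p : ℤ) - q)
    exact pow_eq_zero_iff two_ne_zero |>.1 (by linarith)
  obtain rfl : p = q := by omega
  have hd3 : d + 2 = 3 * p := by omega
  have hcard' : Nat.card G = 3 * p ^ 2 := by
    have : (d : ℤ) + 2 = 3 * p := by omega
    rw [this] at hcard
    zify
    linarith
  obtain ⟨rfl, rfl⟩ : m = 2 * p ∧ n = 2 * p := by
    obtain ⟨x, rfl⟩ := Nat.exists_eq_add_of_le hqn
    rw [hcard', Nat.add_sub_cancel_left] at hN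
    have : p * (3 * p) ≤ p * (m + x) := by linarith
    have := Nat.le_of_mul_le_mul_left this hp
    omega
  have h0 : p • a + p • b = 0 := by
    rcases hor with h | h
    · omega
    · exact h.2.2
  -- The cells just past the two arms give the relations `(2 * p) • a = s • b` and `(2 * p) • b = r
  -- • a`.
  obtain ⟨s, hs, hsa⟩ := exists_isMinRep_zero_left (a := a) (b := b) (p := 2 * p - 1) (q := 0)
    (by rw [key]; omega) (by rw [key]; omega)
  obtain ⟨r, hr, hrb⟩ := exists_isMinRep_zero_right (a := a) (b := b) (p := 0) (q := 2 * p - 1)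
    (by rw [key]; omega) (by rw [key]; omega)
  rw [Nat.sub_add_cancel (by omega), zero_nsmul, two_mul, add_nsmul] at hsa hrb
  rw [add_zero] at hsa
  rw [zero_add] at hrb
  have hs' := (key _ _).1 hs
  have hr' := (key _ _).1 hr
  have hb : p • b = -(p • a) := eq_neg_of_add_eq_zero_right h0
  have hsa' : p • a = (s + p) • b := by rw [add_nsmul, hsa, hb]; abel
  have hrb' : p • b = (r + p) • a := by rw [add_nsmul, hrb, hb]; abel
  have hsp : p ≤ s := by
    by_contra hlt
    have := ((key p 0).2 (by omega)).unique ((key 0 (s + p)).2 (by omega)) (by simpa using hsa')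
    omega
  have hrp : p ≤ r := by
    by_contra hlt
    have := ((key 0 p).2 (by omega)).unique ((key (r + p) 0).2 (by omega)) (by simpa using hrb')
    omega
  obtain ⟨y, rfl⟩ := Nat.exists_eq_add_of_le hsp
  -- Here `y = s - p < p`, so `(r, y)` lies in the shape and represents `p • a`; hence `r = s = p`.
  have h3 := ((key p 0).2 (by omega)).unique ((key r y).2 (by omega)) (by
    rw [zero_nsmul, add_zero, hsa', hrb, add_nsmul, add_nsmul]; abel)
  obtain ⟨rfl, rfl⟩ := h3
  have ha : (3 * p) • a = 0 := by
    rw [show 3 * p = p + p + p by ring, add_nsmul, add_nsmul, ← hsa, add_zero, add_comm]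
    exact h0
  have hb' : (3 * p) • b = 0 := by
    rw [show 3 * p = p + p + p by ring, add_nsmul, add_nsmul, ← hrb]
    exact h0
  obtain ⟨i, j, -, rfl⟩ := hc g
  rw [hd3, nsmul_add, nsmul_left_comm a, nsmul_left_comm b, ha, hb', nsmul_zero, nsmul_zero,
    add_zero]

end MinRep

/-! ### Constructions -/

theorem zmod_covers {N d : ℕ} (hN : 0 < N) (x y : ℤ)
    (h : ∀ n : ℤ, 0 ≤ n → n < N → ∃ i j c : ℤ, 0 ≤ i ∧ 0 ≤ j ∧ i + j ≤ d ∧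
      i * x + j * y = n + c * N) :
    Covers (x : ZMod N) (y : ZMod N) d := by
  have : NeZero N := ⟨hN.ne'⟩
  intro g
  obtain ⟨i, j, c, hi, hj, hij, he⟩ := h (g.val : ℤ) (by positivity)
    (by exact_mod_cast g.val_lt)
  lift i to ℕ using hi
  lift j to ℕ using hj
  refine ⟨i, j, by exact_mod_cast hij, ?_⟩
  have := congrArg (Int.cast : ℤ → ZMod N) he
  push_cast at this
  simpa using this

theorem zmod_intCast_ne {N : ℕ} {x y : ℤ} (h : y < x) (h' : x < y + N) :
    (x : ZMod N) ≠ (y : ZMod N) := by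
  intro he
  have h1 := (ZMod.intCast_eq_intCast_iff_dvd_sub y x N).1 he.symm
  have := Int.le_of_dvd (by linarith) h1
  linarith

theorem hasCayleyDiamLE_zmod {N d : ℕ} {x y : ℤ} (hyx : y < x) (hx : x < y + N)
    (h : ∀ n : ℤ, 0 ≤ n → n < N → ∃ i j c : ℤ, 0 ≤ i ∧ 0 ≤ j ∧ i + j ≤ d ∧
      i * x + j * y = n + c * N) :
    HasCayleyDiamLE (ZMod N) d 2 :=
  (hasCayleyDiamLE_two_iff d).2
    ⟨x, y, zmod_intCast_ne hyx hx, zmod_covers (by omega) x y h⟩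

/-- Divide `n` by `x = 3 * t - 1`. Remainders that are too large are shortened by the relation `(t +
1) * x - 2 * t = N`. -/
theorem hasCayleyDiamLE_zmod_one {t N d : ℕ} (ht : 2 ≤ t) (hd : d + 2 = 3 * t)
    (hN : N + 1 = 3 * t ^ 2) : HasCayleyDiamLE (ZMod N) d 2 := by
  zify at hN ht hd
  have hN' : (N : ℤ) = t * (3 * t - 1) + (t - 1) := by linarith
  refine hasCayleyDiamLE_zmod (x := 3 * t - 1) (y := 1) (by linarith) (by nlinarith) ?_
  intro n hn0 hn
  have hpos : (0 : ℤ) < 3 * t - 1 := by linarith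
  have hdm := Int.mul_ediv_add_emod n (3 * t - 1)
  have hj0 := Int.emod_nonneg n hpos.ne'
  have hj := Int.emod_lt_of_pos n hpos
  have hi0 : 0 ≤ n / (3 * t - 1) := Int.ediv_nonneg hn0 hpos.le
  generalize n / (3 * (t : ℤ) - 1) = i at *
  generalize n % (3 * (t : ℤ) - 1) = j at *
  rcases lt_or_ge i t with hi | hi
  · rcases lt_or_ge j (2 * t) with hj' | hj'
    · exact ⟨i, j, 0, hi0, hj0, by linarith, by linarith⟩
    · exact ⟨i + t + 1, j - 2 * t, 1, by linarith, by linarith, by linarith, by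
        rw [hN', ← hdm]; ring⟩
  · have hit : i = t := by
      have : i < t + 1 := by nlinarith
      omega
    subst hit
    exact ⟨t, j, 0, hi0, hj0, by linarith, by linarith⟩

theorem hasCayleyDiamLE_zmod_two {t N d : ℕ} (ht : 1 ≤ t) (hd : d + 1 = 3 * t)
    (hN : N = 3 * t ^ 2 + 2 * t) : HasCayleyDiamLE (ZMod N) d 2 := by
  zify at hN ht hd
  have hN' : (N : ℤ) = t * (3 * t + 1) + t := by linarith
  refine hasCayleyDiamLE_zmod (x := 3 * t + 1) (y := 1) (by linarith) (by nlinarith) ?_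
  intro n hn0 hn
  have hpos : (0 : ℤ) < 3 * t + 1 := by linarith
  have hdm := Int.mul_ediv_add_emod n (3 * t + 1)
  have hj0 := Int.emod_nonneg n hpos.ne'
  have hj := Int.emod_lt_of_pos n hpos
  have hi0 : 0 ≤ n / (3 * t + 1) := Int.ediv_nonneg hn0 hpos.le
  generalize n / (3 * (t : ℤ) + 1) = i at *
  generalize n % (3 * (t : ℤ) + 1) = j at *
  rcases lt_or_ge i t with hi | hi
  · rcases le_or_gt j (2 * t) with hj' | hj'
    · exact ⟨i, j, 0, hi0, hj0, by linarith, by linarith⟩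
    -- Uses `(t + 1) * (3 * t + 1) - (2 * t + 1) = N`.
    · exact ⟨i + t + 1, j - 2 * t - 1, 1, by linarith, by linarith, by linarith, by
        rw [hN', ← hdm]; ring⟩
  · have hit : i = t := by
      have : i < t + 1 := by nlinarith
      omega
    subst hit
    exact ⟨t, j, 0, hi0, hj0, by linarith, by linarith⟩

theorem hasCayleyDiamLE_zmod_zero {t N d : ℕ} (ht : 1 ≤ t) (hd : d = 3 * t)
    (hN : N = 3 * t ^ 2 + 4 * t + 1) : HasCayleyDiamLE (ZMod N) d 2 := by
  zify at hN ht hd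
  have hN' : (N : ℤ) = t * (3 * t + 2) + (2 * t + 1) := by linarith
  refine hasCayleyDiamLE_zmod (x := 3 * t + 2) (y := -1) (by linarith) (by nlinarith) ?_
  intro n hn0 hn
  have hpos : (0 : ℤ) < 3 * t + 2 := by linarith
  -- As `y = -1`, the quotient is rounded up: `n = (3 * t + 2) * i - j`.
  have hdm := Int.mul_ediv_add_emod (n + (3 * t + 1)) (3 * t + 2)
  have hj0 := Int.emod_nonneg (n + (3 * t + 1)) hpos.ne'
  have hj := Int.emod_lt_of_pos (n + (3 * t + 1)) hpos
  have hi0 : 0 ≤ (n + (3 * t + 1)) / (3 * t + 2) := Int.ediv_nonneg (by linarith) hpos.le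
  generalize (n + (3 * (t : ℤ) + 1)) / (3 * (t : ℤ) + 2) = i at *
  obtain ⟨j, hjdef⟩ : ∃ j, j = 3 * (t : ℤ) + 1 - (n + (3 * t + 1)) % (3 * t + 2) := ⟨_, rfl⟩
  have hnj : n = (3 * t + 2) * i - j := by linarith
  rcases le_or_gt i t with hi | hi
  · rcases le_or_gt j (2 * t) with hj' | hj'
    · exact ⟨i, j, 0, hi0, by linarith, by linarith, by linarith⟩
    · exact ⟨i + t, j - 2 * t - 1, 1, by linarith, by linarith, by linarith, by
        rw [hN', hnj]; ring⟩
  · have hit : i = t + 1 := by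
      have : i < t + 2 := by nlinarith
      omega
    -- The top row is wrapped by `(t + 1) * x + (t + 1) * y = N`; `n < N` gives `j ≥ t + 1`.
    subst hit
    exact ⟨0, j - t - 1, -1, le_rfl, by nlinarith, by linarith, by
      rw [hN', hnj]; ring⟩

theorem hasCayleyDiamLE_zmod_prod {t d : ℕ} (ht : 2 ≤ t) (hd : d + 2 = 3 * t) :
    HasCayleyDiamLE (ZMod t × ZMod (3 * t)) d 2 := by
  have : NeZero t := ⟨by omega⟩
  have : NeZero (3 * t) := ⟨by omega⟩
  have : Fact (1 < t) := ⟨by omega⟩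
  refine (hasCayleyDiamLE_two_iff d).2 ⟨(1, 1), (0, -1), fun h => ?_, ?_⟩
  · exact one_ne_zero (congrArg Prod.fst h)
  rintro ⟨u, v⟩
  have hu := u.val_lt
  set w : ZMod (3 * t) := (u.val : ZMod (3 * t)) - v with hw
  have hwlt := w.val_lt
  have hv : v = (u.val : ZMod (3 * t)) - (w.val : ZMod (3 * t)) := by
    rw [ZMod.natCast_zmod_val w, hw]; ring
  rcases lt_or_ge w.val (2 * t) with h | h
  · refine ⟨u.val, w.val, by omega, Prod.ext ?_ ?_⟩
    · simp
    · rw [hv]; simp [sub_eq_add_neg]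
  -- The generators satisfy `t • a = (2 * t) • b`.
  · refine ⟨u.val + t, w.val - 2 * t, by omega, Prod.ext ?_ ?_⟩
    · simp
    · have h3 : ((3 * t : ℕ) : ZMod (3 * t)) = 0 := ZMod.natCast_self _
      rw [hv]
      simp only [Prod.smul_mk, Prod.mk_add_mk, nsmul_eq_mul, Nat.cast_sub h]
      push_cast at h3 ⊢
      linear_combination h3

/-! ### The maxima -/

theorem mem_abelianOrders_of_cyclicOrders {d k m : ℕ} (h : m ∈ cyclicOrders d k) :
    m ∈ abelianOrders d k :=
  ⟨h.1, ZMod m, inferInstance, Nat.card_zmod m, h.2⟩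

theorem three_mul_le_of_mem_abelianOrders {d m : ℕ} (h : m ∈ abelianOrders d 2) :
    3 * m ≤ (d + 2) ^ 2 := by
  obtain ⟨-, Γ, _, rfl, h⟩ := h
  obtain ⟨a, b, -, hc⟩ := (hasCayleyDiamLE_two_iff d).1 h
  exact hc.three_mul_card_le

theorem three_mul_lt_of_mem_cyclicOrders {d m : ℕ} (hd : 2 ≤ d) (h : m ∈ cyclicOrders d 2) :
    3 * m < (d + 2) ^ 2 := by
  refine lt_of_le_of_ne (three_mul_le_of_mem_abelianOrders (mem_abelianOrders_of_cyclicOrders h))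
    fun he => ?_
  obtain ⟨a, b, -, hc⟩ := (hasCayleyDiamLE_two_iff d).1 h.2
  -- Applied to `1`, the exponent bound gives `m ∣ d + 2`, impossible as `3 * m = (d + 2) ^ 2` and
  -- `d + 2 > 3`.
  have h1 := hc.nsmul_eq_zero (by rwa [Nat.card_zmod]) 1
  rw [nsmul_one, ZMod.natCast_eq_zero_iff] at h1
  have := Nat.le_of_dvd (by omega) h1
  nlinarith

theorem isGreatest_orders {d : ℕ} (hd : 2 ≤ d) : ∃ N : ℕ,
    IsGreatest (cyclicOrders d 2) N ∧
    (N : ℤ) = ⌈((d : ℚ) + 2) ^ 2 / 3⌉ - 1 ∧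
    (d ≡ 1 [MOD 3] → IsGreatest (abelianOrders d 2) (N + 1)) ∧
    (¬ d ≡ 1 [MOD 3] → IsGreatest (abelianOrders d 2) N) := by
  have hceil : ∀ N : ℕ, 3 * N < (d + 2) ^ 2 → (d + 2) ^ 2 ≤ 3 * (N + 1) →
      (N : ℤ) = ⌈((d : ℚ) + 2) ^ 2 / 3⌉ - 1 := by
    intro N h1 h2
    have h1' : 3 * (N : ℚ) < ((d : ℚ) + 2) ^ 2 := by exact_mod_cast h1
    have h2' : ((d : ℚ) + 2) ^ 2 ≤ 3 * ((N : ℚ) + 1) := by exact_mod_cast h2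
    have : ⌈((d : ℚ) + 2) ^ 2 / 3⌉ = (N : ℤ) + 1 := by
      rw [Int.ceil_eq_iff]
      push_cast
      constructor <;> linarith
    omega
  have hgreat : ∀ N : ℕ, HasCayleyDiamLE (ZMod N) d 2 → 0 < N → 3 * N < (d + 2) ^ 2 →
      (d + 2) ^ 2 ≤ 3 * (N + 1) → IsGreatest (cyclicOrders d 2) N := by
    refine fun N h h0 _ h2 => ⟨⟨h0, h⟩, fun k hk => ?_⟩
    have := three_mul_lt_of_mem_cyclicOrders hd hk
    omega
  have hgreat' : ∀ N : ℕ, HasCayleyDiamLE (ZMod N) d 2 → 0 < N →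
      (d + 2) ^ 2 < 3 * (N + 1) → IsGreatest (abelianOrders d 2) N := by
    refine fun N h h0 h2 => ⟨mem_abelianOrders_of_cyclicOrders ⟨h0, h⟩, fun k hk => ?_⟩
    have := three_mul_le_of_mem_abelianOrders hk
    omega
  have hmod : d % 3 = 0 ∨ d % 3 = 1 ∨ d % 3 = 2 := by omega
  rcases hmod with h | h | h
  · obtain ⟨t, rfl⟩ : ∃ t, d = 3 * t := ⟨d / 3, by omega⟩
    have hz := hasCayleyDiamLE_zmod_zero (t := t) (by omega) rfl rfl
    refine ⟨3 * t ^ 2 + 4 * t + 1, hgreat _ hz (by omega) (by nlinarith) (by nlinarith),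
      hceil _ (by nlinarith) (by nlinarith), fun h' => ?_,
      fun _ => hgreat' _ hz (by omega) (by nlinarith)⟩
    rw [Nat.ModEq] at h'
    omega
  · obtain ⟨t, ht⟩ : ∃ t, d + 2 = 3 * t := ⟨(d + 2) / 3, by omega⟩
    have ht2 : 2 ≤ t := by omega
    obtain ⟨N, hN⟩ : ∃ N, N + 1 = 3 * t ^ 2 := ⟨3 * t ^ 2 - 1, by
      have : 0 < t ^ 2 := by positivity
      omega⟩
    have hz := hasCayleyDiamLE_zmod_one ht2 ht hN
    have hsq : (d + 2) ^ 2 = 3 * (N + 1) := by rw [ht, hN]; ring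
    have hN0 : 0 < N := by nlinarith
    refine ⟨N, hgreat _ hz hN0 (by omega) hsq.le, hceil _ (by omega) hsq.le, fun _ => ?_,
      fun h' => absurd h h'⟩
    refine ⟨⟨by omega, ZMod t × ZMod (3 * t), inferInstance, ?_,
      hasCayleyDiamLE_zmod_prod ht2 ht⟩, fun k hk => ?_⟩
    · rw [Nat.card_prod, Nat.card_zmod, Nat.card_zmod, hN]; ring
    · have := three_mul_le_of_mem_abelianOrders hk
      omega
  · obtain ⟨t, ht⟩ : ∃ t, d + 1 = 3 * t := ⟨(d + 1) / 3, by omega⟩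
    have ht1 : 1 ≤ t := by omega
    have hz := hasCayleyDiamLE_zmod_two ht1 ht rfl
    have hsq : (d + 2) ^ 2 = 3 * (3 * t ^ 2 + 2 * t) + 1 := by
      rw [show d + 2 = 3 * t + 1 by omega]; ring
    refine ⟨3 * t ^ 2 + 2 * t, hgreat _ hz (by positivity) (by omega) (by omega),
      hceil _ (by omega) (by omega), fun h' => ?_,
      fun _ => hgreat' _ hz (by positivity) (by omega)⟩
    rw [Nat.ModEq] at h'
    omega

end CayleyTwo

/-- Besides the formulas, the first two conjuncts say that the suprema defining `m_*(d, 2)` and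
`m(d, 2)` are really attained maxima; the last part says that the equality
`m_*(d, k) = m(d, k)` fails already for `k = 2`. -/
theorem mainTheorem1 :
    (∀ d : ℕ, 2 ≤ d →
      IsGreatest (abelianOrders d 2) (mStar d 2) ∧
      IsGreatest (cyclicOrders d 2) (mCyc d 2) ∧
      (mCyc d 2 : ℤ) = ⌈((d : ℚ) + 2) ^ 2 / 3⌉ - 1 ∧
      (d ≡ 1 [MOD 3] → mStar d 2 = mCyc d 2 + 1) ∧
      (¬ d ≡ 1 [MOD 3] → mStar d 2 = mCyc d 2)) ∧
    (∃ d : ℕ, 2 ≤ d ∧ mStar d 2 ≠ mCyc d 2) := by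
  have main : ∀ d : ℕ, 2 ≤ d →
      IsGreatest (abelianOrders d 2) (mStar d 2) ∧
      IsGreatest (cyclicOrders d 2) (mCyc d 2) ∧
      (mCyc d 2 : ℤ) = ⌈((d : ℚ) + 2) ^ 2 / 3⌉ - 1 ∧
      (d ≡ 1 [MOD 3] → mStar d 2 = mCyc d 2 + 1) ∧
      (¬ d ≡ 1 [MOD 3] → mStar d 2 = mCyc d 2) := by
    intro d hd
    obtain ⟨N, hcyc, hceil, h1, h2⟩ := CayleyTwo.isGreatest_orders hd
    have hm : mCyc d 2 = N := hcyc.csSup_eq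
    rw [hm]
    by_cases h : d ≡ 1 [MOD 3]
    · have hs : mStar d 2 = N + 1 := (h1 h).csSup_eq
      rw [hs]
      exact ⟨h1 h, hcyc, hceil, fun _ => rfl, fun h' => absurd h h'⟩
    · have hs : mStar d 2 = N := (h2 h).csSup_eq
      rw [hs]
      exact ⟨h2 h, hcyc, hceil, fun h' => absurd h' h, fun _ => rfl⟩
  refine ⟨main, 4, by norm_num, ?_⟩
  have := (main 4 (by norm_num)).2.2.2.1 rfl
  omega
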